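/- Let $T>0$, $d\ge 0$, let $\mathrm{Conv}(\mathbb R^d)$ be the family of nonempty compact convex subsets of $\mathbb R^d$ (Euclidean norm), $H$ the Hausdorff distance, and $\|A\|=H(A,\{0\})$. A function $F:[0,T]\to \mathrm{Conv}(\mathbb R^d)$ is Hukuhara differentiable if for every $t\in[0,T]$ there is $D_HF(t)\in\mathrm{Conv}(\mathbb R^d)$ such that for all small $h>0$ there are sets $C_h^{+},C_h^{-}\in\mathrm{Conv}(\mathbb R^d)$ with $F(t+h)=F(t)+C_h^{+}$ and $F(t)=F(t-h)+C_h^{-}$ (Minkowski sums), and $h^{-1}C_h^{\pm}\to D_HF(t)$ in $H$ as $h\to0+$ (only $C_h^{+}$ is considered at $t=0$, only $C_h^{-}$ at $t=T$). For $1<p<\infty$ let $\mathcal{IS}(F)$ be the set of functions $f:[0,T]\to\mathbb R^d$ with finite Riesz $p$-variation $$\sup_{0=t_0<\dots<t_n=T}\ \sum_{i=1}^n\frac{\|f(t_i)-f(t_{i-1})\|^p}{(t_i-t_{i-1})^{p-1}}<\infty ,$$ with $f(t)\in F(t)$ for all $t\in[0,T]$, and whose (a.e. existing) derivative satisfies $f'\in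 L^p$ and $f'(t)\in D_HF(t)$ for a.e. $t\in[0,T]$. For $g:[0,T]\to\mathbb R$ and $t\in[0,T]$ put $$(\mathcal{IS})\int_0^tF\,dg=\mathrm{cl}\Big\{\int_0^tf\,dg:\ f\in\mathcal{IS}(F)\Big\},$$ where $\int_0^tf\,dg$ is the Young integral, i.e. the limit of the sums $\sum_i f(t_{i-1})(g(t_i)-g(t_{i-1}))$ over partitions of $[0,t]$ as the mesh tends to $0$. Let $\alpha,\beta\in(0,1]$, let $g:[0,T]\to\mathbb R$ be $\alpha$-Hölder, $M_\alpha(g)=\sup_{0\le s<t\le T}|g(t)-g(s)|/(t-s)^\alpha$, and let $\rho\in(1-\alpha,\beta)$. Then there is a constant $C(\rho)>0$ (which may depend on $T,d,\alpha,\beta,g,\rho$ only) such that for every $p>1$ with $1/p+\alpha>1$ and all Hukuhara differentiable $F_1,F_2:[0,T]\to\mathrm{Conv}(\mathbb R^d)$ with bounded Hukuhara derivatives and $F_1(0)=F_2(0)$ the following holds. The function $s\mapsto H(D_HF_1(s),D_HF_2(s))$ is integrable on $[0,T]$; for every $t\in[0,T]$ the Young integrals $\int_0^tf\,dg$, $f\in\mathcal{IS}(F_1)\cup\mathcal{IS}(F_2)$,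 exist and the sets $(\mathcal{IS})\int_0^tF_i\,dg$, $i=1,2$, are nonempty and compact; and for every $t\in[0,T]$ and $\theta\in(0,1]$ $$H\Big((\mathcal{IS})\!\int_0^tF_1\,dg,\ (\mathcal{IS})\!\int_0^tF_2\,dg\Big)\le C(\rho)\Big(\int_0^TH(D_HF_1(s),D_HF_2(s))\,ds+(T+T^{1-\beta})\big(\sup_{[0,T]}\|D_HF_1\|+\sup_{[0,T]}\|D_HF_2\|\big)\theta^{\beta}\Big)\theta^{-\rho}$$ $$\qquad{}+M_\alpha(g)\,T^{\alpha}\int_0^TH(D_HF_1(s),D_HF_2(s))\,ds .$$ -/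

import Mathlib

open Set Filter Topology MeasureTheory
open scoped ENNReal

namespace SetYoung

noncomputable section

/-- `u 0 < u 1 < ... < u n` is a partition of `[a, b]` (for `a = b` only `n = 0` is possible). -/
structure IsPartition (a b : ℝ) (n : ℕ) (u : ℕ → ℝ) : Prop where
  left : u 0 = a
  right : u n = b
  lt : ∀ i < n, u i < u (i + 1)

/-- The quotients `|g t - g s| / (t - s) ^ α`, `0 ≤ s < t ≤ T`. -/
def holderQuotients (α T : ℝ) (g : ℝ → ℝ) : Set ℝ :=
  {r | ∃ s t : ℝ, 0 ≤ s ∧ s < t ∧ t ≤ T ∧ r = |g t - g s| / (t - s) ^ α}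

/-- `g` is `α`-Hölder on `[0, T]`. -/
def IsHolder (α T : ℝ) (g : ℝ → ℝ) : Prop :=
  BddAbove (holderQuotients α T g)

/-- The Hölder constant `M_α(g)` on `[0, T]`. -/
def holderConst (α T : ℝ) (g : ℝ → ℝ) : ℝ :=
  sSup (holderQuotients α T g)

section

variable {E : Type*} [NormedAddCommGroup E] [NormedSpace ℝ E]

/-- The Riesz `p`-variation of `f` on `[0, T]`. -/
def rieszVariation (p T : ℝ) (f : ℝ → E) : ℝ≥0∞ :=
  ⨆ (n : ℕ) (u : ℕ → ℝ) (_ : IsPartition 0 T n u),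
    ∑ i ∈ Finset.range n,
      ENNReal.ofReal (dist (f (u i)) (f (u (i + 1))) ^ p / (u (i + 1) - u i) ^ (p - 1))

/-- `f` has bounded Riesz `p`-variation on `[0, T]`. -/
def MemBV (p T : ℝ) (f : ℝ → E) : Prop :=
  rieszVariation p T f < ⊤

/-- The Hukuhara difference `A ÷ B` exists and is `C`. -/
def IsHukuharaDiff (A B C : ConvexBody E) : Prop :=
  A = B + C

/-- `D` is the Hukuhara derivative at `t ∈ [0, T]` of `F : [0, T] → Conv E`: both difference
quotients exist for small increments and tend to `D` in the Hausdorff metric. At `t = 0` only the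
right and at `t = T` only the left quotient is considered. -/
def HasHukuharaDerivAt (T : ℝ) (F : ℝ → ConvexBody E) (D : ConvexBody E) (t : ℝ) : Prop :=
  (t < T → ∃ C : ℝ → ConvexBody E,
    (∀ᶠ h in 𝓝[>] (0 : ℝ), IsHukuharaDiff (F (t + h)) (F t) (C h)) ∧
      Tendsto (fun h : ℝ => h⁻¹ • C h) (𝓝[>] 0) (𝓝 D)) ∧
  (0 < t → ∃ C : ℝ → ConvexBody E,
    (∀ᶠ h in 𝓝[>] (0 : ℝ), IsHukuharaDiff (F t) (F (t - h)) (C h)) ∧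
      Tendsto (fun h : ℝ => h⁻¹ • C h) (𝓝[>] 0) (𝓝 D))

/-- `F` is Hukuhara differentiable at every point of `[0, T]`. -/
def HukuharaDifferentiable (T : ℝ) (F : ℝ → ConvexBody E) : Prop :=
  ∀ t ∈ Icc 0 T, ∃ D, HasHukuharaDerivAt T F D t

open Classical in
/-- The Hukuhara derivative `D_H F` (with the value `{0}` where it does not exist). -/
def hukuharaDeriv (T : ℝ) (F : ℝ → ConvexBody E) (t : ℝ) : ConvexBody E :=
  if h : ∃ D, HasHukuharaDerivAt T F D t then h.choose else 0

/-- `‖A‖ = H(A, {0})`. -/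
def setNorm (A : ConvexBody E) : ℝ := dist A 0

/-- The numbers `‖D_H F(t)‖`, `t ∈ [0, T]`. -/
def derivNorms (T : ℝ) (F : ℝ → ConvexBody E) : Set ℝ :=
  (fun t => setNorm (hukuharaDeriv T F t)) '' Icc 0 T

/-- `IS(F)`: the selections `f` of `F` on `[0, T]` of bounded Riesz `p`-variation whose
(almost everywhere existing) derivative is an `L^p` selection of `D_H F`. -/
def IS (p T : ℝ) (F : ℝ → ConvexBody E) : Set (ℝ → E) :=
  {f | MemBV p T f ∧ (∀ t ∈ Icc 0 T, f t ∈ F t) ∧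
    MemLp (deriv f) (ENNReal.ofReal p) (volume.restrict (Icc 0 T)) ∧
    ∀ᵐ t ∂(volume.restrict (Icc 0 T)),
      DifferentiableAt ℝ f t ∧ deriv f t ∈ hukuharaDeriv T F t}

/-- The left-point Riemann sum of `f` with respect to `g`. -/
def riemannSum (f : ℝ → E) (g : ℝ → ℝ) (n : ℕ) (u : ℕ → ℝ) : E :=
  ∑ i ∈ Finset.range n, (g (u (i + 1)) - g (u i)) • f (u i)

/-- The Young integral of `f` with respect to `g` over `[a, b]` exists and equals `x`: the Riemann
sums converge to `x` as the mesh of the partition tends to `0`. -/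
def HasYoungIntegral (f : ℝ → E) (g : ℝ → ℝ) (a b : ℝ) (x : E) : Prop :=
  ∀ ε > 0, ∃ δ > 0, ∀ (n : ℕ) (u : ℕ → ℝ), IsPartition a b n u →
    (∀ i < n, u (i + 1) - u i < δ) → ‖riemannSum f g n u - x‖ < ε

/-- The set-valued Young integral of `F` with respect to `g` over `[0, t]`, for `t ∈ [0, T]`. -/
def setYoungIntegral (p T : ℝ) (F : ℝ → ConvexBody E) (g : ℝ → ℝ) (t : ℝ) : Set E :=
  closure {x | ∃ f ∈ IS p T F, HasYoungIntegral f g 0 t x}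

end

end

end SetYoung

open SetYoung

/-! Integration by parts makes the estimate linear in derivatives. If `f = a + ∫ φ` with `φ`
bounded, the Young integral over `[0, t]` is `(g t - g 0) a + ∫₀ᵗ (g t - g s) φ(s) ds`
(`youngValue`, `hasYoungIntegral_youngValue`). Two such functions with the same initial value
therefore have Young integrals at distance at most `M_α(g) T^α ∫ ‖φ - ψ‖`
(`norm_youngValue_sub_le`).

Given `f ∈ IS(F₁)`, put `φ(s)` equal to the metric projection of `f'(s)` onto `D_H F₂(s)`, so that
`‖f'(s) - φ(s)‖ ≤ H(D_H F₁(s), D_H F₂(s))` for a.e. `s`. Then `f 0 + ∫ φ` belongs to `IS(F₂)`, and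
by symmetry the last term of the estimate alone bounds the Hausdorff distance. The other term is
nonnegative, so `C = 1` suffices.

Two facts carry this argument. Support functions turn Hukuhara derivatives into ordinary ones, so
integrals of selections of `D_H F` starting in `F 0` stay in `F` (`add_integral_mem`). Finite Riesz
variation gives absolute continuity, so every `f ∈ IS(F)` is the integral of its derivative
(`MemBV.eq_add_integral_deriv`). -/

namespace SetYoung

noncomputable section

/-! ### Support functions and metric projections of convex bodies. -/

section ConvexBodies

open scoped Pointwise

variable {E : Type*} [NormedAddCommGroup E] [InnerProductSpace ℝ E]

/-- The support function of a convex body. -/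
def supportFn (K : ConvexBody E) (u : E) : ℝ := sSup ((fun x => inner ℝ x u) '' (K : Set E))

theorem exists_inner_eq_supportFn (K : ConvexBody E) (u : E) :
    ∃ x ∈ K, inner ℝ x u = supportFn K u := by
  have hc : ContinuousOn (fun x => inner ℝ x u) (K : Set E) := by fun_prop
  obtain ⟨x, hx, h⟩ := (K.isCompact.image_of_continuousOn hc).sSup_mem (K.nonempty.image _)
  exact ⟨x, hx, h⟩

theorem inner_le_supportFn {K : ConvexBody E} {x : E} (hx : x ∈ K) (u : E) :
    inner ℝ x u ≤ supportFn K u := by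
  have hc : ContinuousOn (fun x => inner ℝ x u) (K : Set E) := by fun_prop
  exact le_csSup (K.isCompact.image_of_continuousOn hc).bddAbove ⟨x, hx, rfl⟩

theorem supportFn_add (A B : ConvexBody E) (u : E) :
    supportFn (A + B) u = supportFn A u + supportFn B u := by
  apply le_antisymm
  · obtain ⟨x, hx, h⟩ := exists_inner_eq_supportFn (A + B) u
    obtain ⟨a, ha, b, hb, rfl⟩ := Set.mem_add.1 (show x ∈ (A : Set E) + B from hx)
    rw [← h, inner_add_left]
    exact add_le_add (inner_le_supportFn ha u) (inner_le_supportFn hb u)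
  · obtain ⟨a, ha, h⟩ := exists_inner_eq_supportFn A u
    obtain ⟨b, hb, h'⟩ := exists_inner_eq_supportFn B u
    rw [← h, ← h', ← inner_add_left]
    exact inner_le_supportFn (K := A + B) (Set.add_mem_add ha hb) u

theorem supportFn_smul {c : ℝ} (hc : 0 ≤ c) (A : ConvexBody E) (u : E) :
    supportFn (c • A) u = c * supportFn A u := by
  apply le_antisymm
  · obtain ⟨x, hx, h⟩ := exists_inner_eq_supportFn (c • A) u
    obtain ⟨a, ha, rfl⟩ := Set.mem_smul_set.1 (show x ∈ c • (A : Set E) from hx)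
    rw [← h, real_inner_smul_left]
    exact mul_le_mul_of_nonneg_left (inner_le_supportFn ha u) hc
  · obtain ⟨a, ha, h⟩ := exists_inner_eq_supportFn A u
    rw [← h, ← real_inner_smul_left]
    exact inner_le_supportFn (K := c • A) (Set.smul_mem_smul_set ha) u

theorem exists_dist_le_dist {A : ConvexBody E} (B : ConvexBody E) {x : E} (hx : x ∈ A) :
    ∃ y ∈ B, dist x y ≤ dist A B := by
  obtain ⟨y, hy, h⟩ := B.isCompact.exists_infDist_eq_dist B.nonempty x
  refine ⟨y, hy, ?_⟩
  rw [← h]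
  exact Metric.infDist_le_hausdorffDist_of_mem (s := (A : Set E)) hx
    ConvexBody.hausdorffEDist_ne_top

theorem setNorm_nonneg (A : ConvexBody E) : 0 ≤ setNorm A := dist_nonneg

theorem norm_le_setNorm {A : ConvexBody E} {x : E} (hx : x ∈ A) : ‖x‖ ≤ setNorm A := by
  obtain ⟨y, hy, h⟩ := exists_dist_le_dist 0 hx
  obtain rfl : y = 0 := hy
  simpa [setNorm] using h

theorem supportFn_le_add_dist (A B : ConvexBody E) (u : E) :
    supportFn A u ≤ supportFn B u + dist A B * ‖u‖ := by
  obtain ⟨x, hx, h⟩ := exists_inner_eq_supportFn A u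
  obtain ⟨y, hy, hxy⟩ := exists_dist_le_dist B hx
  have h1 := inner_le_supportFn hy u
  have h2 : inner ℝ (x - y) u ≤ dist A B * ‖u‖ :=
    (real_inner_le_norm _ _).trans (by rw [← dist_eq_norm]; gcongr)
  rw [inner_sub_left] at h2
  linarith

theorem abs_supportFn_sub_le (A B : ConvexBody E) (u : E) :
    |supportFn A u - supportFn B u| ≤ dist A B * ‖u‖ := by
  have h1 := supportFn_le_add_dist A B u
  have h2 := supportFn_le_add_dist B A u
  rw [dist_comm] at h2
  rw [abs_le]
  constructor <;> linarith

theorem continuous_supportFn_left (u : E) : Continuous fun K : ConvexBody E => supportFn K u := by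
  refine (LipschitzWith.of_dist_le_mul (K := ‖u‖₊) fun A B => ?_).continuous
  rw [Real.dist_eq, coe_nnnorm, mul_comm]
  exact abs_supportFn_sub_le A B u

theorem continuous_supportFn (K : ConvexBody E) : Continuous (supportFn K) := by
  refine (LipschitzWith.of_le_add_mul (setNorm K).toNNReal fun u v => ?_).continuous
  rw [Real.coe_toNNReal _ (setNorm_nonneg K)]
  obtain ⟨x, hx, h⟩ := exists_inner_eq_supportFn K u
  have h1 := inner_le_supportFn hx v
  have h2 : inner ℝ x (u - v) ≤ setNorm K * dist u v := by
    rw [dist_eq_norm]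
    exact (real_inner_le_norm _ _).trans (by gcongr; exact norm_le_setNorm hx)
  rw [inner_sub_right] at h2
  linarith

theorem abs_supportFn_le (K : ConvexBody E) (u : E) : |supportFn K u| ≤ setNorm K * ‖u‖ := by
  obtain ⟨x, hx, h⟩ := exists_inner_eq_supportFn K u
  rw [← h]
  exact (abs_real_inner_le_norm _ _).trans (by gcongr; exact norm_le_setNorm hx)

theorem exists_nearest (K : ConvexBody E) (x : E) :
    ∃ p ∈ K, (∀ y ∈ K, inner ℝ (x - p) (y - p) ≤ 0) ∧ ∀ y ∈ K, dist x p ≤ dist x y := by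
  obtain ⟨p, hp, h⟩ := exists_norm_eq_iInf_of_complete_convex K.nonempty K.isCompact.isComplete
    K.convex x
  refine ⟨p, hp, (norm_eq_iInf_iff_real_inner_le_zero K.convex hp).1 h, fun y hy => ?_⟩
  rw [dist_eq_norm, dist_eq_norm, h]
  exact ciInf_le (f := fun w : (K : Set E) => ‖x - w‖)
    ⟨0, by rintro _ ⟨w, rfl⟩; exact norm_nonneg _⟩ ⟨y, hy⟩

/-- The metric projection onto a convex body. -/
def proj (K : ConvexBody E) (x : E) : E := (exists_nearest K x).choose

theorem proj_mem (K : ConvexBody E) (x : E) : proj K x ∈ K :=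
  (exists_nearest K x).choose_spec.1

theorem inner_sub_proj_le (K : ConvexBody E) (x : E) {y : E} (hy : y ∈ K) :
    inner ℝ (x - proj K x) (y - proj K x) ≤ 0 :=
  (exists_nearest K x).choose_spec.2.1 y hy

theorem dist_proj_le (K : ConvexBody E) (x : E) {y : E} (hy : y ∈ K) :
    dist x (proj K x) ≤ dist x y :=
  (exists_nearest K x).choose_spec.2.2 y hy

theorem dist_proj_le_dist {A : ConvexBody E} (B : ConvexBody E) {x : E} (hx : x ∈ A) :
    dist x (proj B x) ≤ dist A B := by
  obtain ⟨y, hy, h⟩ := exists_dist_le_dist B hx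
  exact (dist_proj_le B x hy).trans h

theorem supportFn_sub_proj (K : ConvexBody E) (x : E) :
    supportFn K (x - proj K x) = inner ℝ (proj K x) (x - proj K x) := by
  apply le_antisymm _ (inner_le_supportFn (proj_mem K x) _)
  obtain ⟨y, hy, h⟩ := exists_inner_eq_supportFn K (x - proj K x)
  have := inner_sub_proj_le K x hy
  rw [real_inner_comm, inner_sub_left] at this
  linarith

/-- In the direction `x - proj K x` the support function is attained at the projection, so the
hypothesis there reads `‖x - proj K x‖ ^ 2 ≤ r * ‖x - proj K x‖`. The case `r = 0` is the separation
theorem. -/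
theorem norm_sub_proj_le {K : ConvexBody E} {x : E} {r : ℝ}
    (h : ∀ u, inner ℝ x u ≤ supportFn K u + r * ‖u‖) (hr : 0 ≤ r) : ‖x - proj K x‖ ≤ r := by
  have h1 := h (x - proj K x)
  rw [supportFn_sub_proj] at h1
  have h2 : inner ℝ (x - proj K x) (x - proj K x) = ‖x - proj K x‖ ^ 2 :=
    real_inner_self_eq_norm_sq _
  rw [inner_sub_left] at h2
  by_contra! h3
  nlinarith [norm_nonneg (x - proj K x)]

theorem mem_of_forall_inner_le {K : ConvexBody E} {x : E}
    (h : ∀ u, inner ℝ x u ≤ supportFn K u) : x ∈ K := by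
  have h1 : ‖x - proj K x‖ ≤ 0 := norm_sub_proj_le (by simpa using h) le_rfl
  rw [norm_le_zero_iff, sub_eq_zero] at h1
  rw [h1]
  exact proj_mem K x

theorem dist_le_of_abs_supportFn_sub_le {A B : ConvexBody E} {r : ℝ} (hr : 0 ≤ r)
    (h : ∀ u, |supportFn A u - supportFn B u| ≤ r * ‖u‖) : dist A B ≤ r := by
  refine Metric.hausdorffDist_le_of_mem_dist hr (fun x hx => ⟨proj B x, proj_mem B x, ?_⟩)
    fun x hx => ⟨proj A x, proj_mem A x, ?_⟩
  · rw [dist_eq_norm]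
    refine norm_sub_proj_le (fun u => ?_) hr
    linarith [(abs_le.1 (h u)).2, inner_le_supportFn (K := A) hx u]
  · rw [dist_eq_norm]
    refine norm_sub_proj_le (fun u => ?_) hr
    linarith [(abs_le.1 (h u)).1, inner_le_supportFn (K := B) hx u]

/-- Each projection satisfies a variational inequality on its own body only. It is tested at a point
of that body within `dist B A` of the other projection, and the two inequalities are added. -/
theorem norm_proj_sub_proj_sq_le (A B : ConvexBody E) (x y : E) :
    ‖proj B y - proj A x‖ ^ 2 ≤
      dist y x ^ 2 + 2 * dist B A * (2 * ‖x - proj A x‖ + dist y x + dist B A) := by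
  set p := proj A x with hp
  set q := proj B y with hq
  obtain ⟨q', hq', hqq⟩ := exists_dist_le_dist A (proj_mem B y)
  obtain ⟨p', hp', hpp⟩ := exists_dist_le_dist B (proj_mem A x)
  rw [← hq, dist_eq_norm] at hqq
  rw [← hp, dist_comm A B, dist_eq_norm] at hpp
  have h1 := inner_sub_proj_le A x hq'
  have h2 := inner_sub_proj_le B y hp'
  rw [← hp] at h1
  rw [← hq] at h2
  have h3 : inner ℝ (x - p) (q - q') ≤ ‖x - p‖ * dist B A :=
    (real_inner_le_norm _ _).trans (by gcongr)
  have h4 : inner ℝ (y - q) (p - p') ≤ ‖y - q‖ * dist B A :=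
    (real_inner_le_norm _ _).trans (by gcongr)
  have h5 : inner ℝ (y - x) (q - p) ≤ dist y x * ‖q - p‖ := by
    rw [dist_eq_norm]; exact real_inner_le_norm _ _
  have h6 : ‖y - q‖ ≤ dist y x + ‖x - p‖ + dist B A := by
    have := dist_proj_le B y hp'
    rw [← hq, dist_eq_norm, dist_eq_norm] at this
    refine this.trans ?_
    rw [show y - p' = (y - x) + (x - p) + (p - p') by abel, dist_eq_norm]
    exact (norm_add₃_le).trans (by gcongr)
  have h7 : ‖q - p‖ ^ 2 = inner ℝ (x - p) (q' - p) + inner ℝ (x - p) (q - q')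
      + (inner ℝ (y - q) (p' - q) + inner ℝ (y - q) (p - p')) + inner ℝ (y - x) (q - p) := by
    rw [← real_inner_self_eq_norm_sq, ← inner_add_right, ← inner_add_right]
    rw [show q' - p + (q - q') = q - p by abel, show p' - q + (p - p') = -(q - p) by abel,
      inner_neg_right, ← sub_eq_add_neg, ← inner_sub_left, ← inner_add_left]
    congr 1
    abel
  have h8 : (0 : ℝ) ≤ dist B A := dist_nonneg
  nlinarith [sq_nonneg (dist y x - ‖q - p‖), mul_le_mul_of_nonneg_right h6 h8]

/-- Joint continuity makes projections onto a measurable family of bodies measurable; this supplies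
the measurable selections of `D_H F`. -/
theorem continuous_proj : Continuous fun q : ConvexBody E × E => proj q.1 q.2 := by
  rw [continuous_iff_continuousAt]
  rintro ⟨A, x⟩
  rw [ContinuousAt, tendsto_iff_norm_sub_tendsto_zero]
  have h : Tendsto (fun q : ConvexBody E × E => dist q.2 x ^ 2 +
      2 * dist q.1 A * (2 * ‖x - proj A x‖ + dist q.2 x + dist q.1 A)) (𝓝 (A, x)) (𝓝 0) := by
    refine Continuous.tendsto' (by fun_prop) _ _ (by simp)
  have h2 := (squeeze_zero (fun q => sq_nonneg _)
    (fun q : ConvexBody E × E => norm_proj_sub_proj_sq_le A q.1 x q.2) h).sqrt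
  simpa using h2

instance [ProperSpace E] : SecondCountableTopology (ConvexBody E) := by
  let i : ConvexBody E → TopologicalSpace.NonemptyCompacts E :=
    fun K => ⟨⟨K, K.isCompact⟩, K.nonempty⟩
  have hi : Isometry i := Isometry.of_dist_eq fun A B => rfl
  exact hi.isEmbedding.secondCountableTopology

end ConvexBodies

/-! ### Measurability of maps into the space of convex bodies. -/

theorem stronglyMeasurable_of_measurable_dist {Ω X : Type*} [MeasurableSpace Ω] [MetricSpace X]
    [SecondCountableTopology X] {f : Ω → X} (h : ∀ c, Measurable fun s => dist (f s) c) :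
    StronglyMeasurable f := by
  borelize X
  refine Measurable.stronglyMeasurable (measurable_of_isOpen fun U hU => ?_)
  obtain ⟨t, htc, htd⟩ := TopologicalSpace.exists_countable_dense X
  have hUe : U = ⋃ c ∈ t, ⋃ (n : ℕ) (_ : Metric.ball c (1 / (n + 1 : ℝ)) ⊆ U),
      Metric.ball c (1 / (n + 1 : ℝ)) := by
    apply subset_antisymm
    · intro x hx
      obtain ⟨ε, hε, hb⟩ := Metric.isOpen_iff.1 hU x hx
      obtain ⟨n, hn⟩ := exists_nat_one_div_lt (half_pos hε)
      obtain ⟨c, hc, hxc⟩ := htd.exists_dist_lt x (Nat.one_div_pos_of_nat (α := ℝ) (n := n))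
      simp only [mem_iUnion]
      refine ⟨c, hc, n, fun y hy => hb ?_, hxc⟩
      rw [Metric.mem_ball] at hy ⊢
      linarith [dist_triangle y c x, dist_comm x c]
    · simp only [iUnion_subset_iff]
      intro c _ n hn
      exact hn
  rw [hUe, preimage_iUnion₂]
  refine MeasurableSet.biUnion htc fun c _ => ?_
  rw [preimage_iUnion₂]
  refine MeasurableSet.iUnion fun n => MeasurableSet.iUnion fun _ => ?_
  exact measurableSet_lt (h c) measurable_const

/-- For `r ≥ 0`, the ball condition `dist (D s) K ≤ r` is a bound on the difference of support
functions in every direction; by continuity in the direction, a countable dense set of directions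
suffices. -/
theorem stronglyMeasurable_of_measurable_supportFn {E : Type*} [NormedAddCommGroup E]
    [InnerProductSpace ℝ E] [ProperSpace E] {Ω : Type*} [MeasurableSpace Ω]
    {D : Ω → ConvexBody E} (h : ∀ u, Measurable fun s => supportFn (D s) u) :
    StronglyMeasurable D := by
  refine stronglyMeasurable_of_measurable_dist fun K => measurable_of_Iic fun r => ?_
  rcases lt_or_ge r 0 with hr | hr
  · convert MeasurableSet.empty
    ext s
    simpa using hr.trans_le dist_nonneg
  · have he : (fun s => dist (D s) K) ⁻¹' Iic r = ⋂ n : ℕ,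
        {s | |supportFn (D s) (TopologicalSpace.denseSeq E n) -
          supportFn K (TopologicalSpace.denseSeq E n)| ≤
            r * ‖TopologicalSpace.denseSeq E n‖} := by
      ext s
      simp only [mem_preimage, mem_Iic, mem_iInter, mem_ofPred_eq]
      constructor
      · intro hs n
        exact (abs_supportFn_sub_le _ _ _).trans (by gcongr)
      · intro hs
        refine dist_le_of_abs_supportFn_sub_le hr fun u => ?_
        have hc : IsClosed {u | |supportFn (D s) u - supportFn K u| ≤ r * ‖u‖} :=
          isClosed_le (((continuous_supportFn _).sub (continuous_supportFn _)).abs)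
            (by fun_prop)
        exact (TopologicalSpace.denseRange_denseSeq E).induction_on
          (p := fun u => |supportFn (D s) u - supportFn K u| ≤ r * ‖u‖) u hc hs
    rw [he]
    exact MeasurableSet.iInter fun n =>
      measurableSet_le ((h _).sub_const _).abs measurable_const

/-! ### Hukuhara derivatives through support functions, and integral selections. -/

section Hukuhara

variable {E : Type*} [NormedAddCommGroup E] [InnerProductSpace ℝ E]

theorem HukuharaDifferentiable.hasHukuharaDerivAt {T : ℝ} {F : ℝ → ConvexBody E}
    (hF : HukuharaDifferentiable T F) {t : ℝ} (ht : t ∈ Icc 0 T) :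
    HasHukuharaDerivAt T F (hukuharaDeriv T F t) t := by
  have h := hF t ht
  rw [hukuharaDeriv, dif_pos h]
  exact h.choose_spec

/-- Support functions are additive under Minkowski sums and continuous in `H`, so Hukuhara quotients
become slopes. -/
theorem HasHukuharaDerivAt.hasDerivWithinAt_supportFn_Ioi {T t : ℝ} {F : ℝ → ConvexBody E}
    {D : ConvexBody E} (h : HasHukuharaDerivAt T F D t) (ht : t < T) (u : E) :
    HasDerivWithinAt (fun s => supportFn (F s) u) (supportFn D u) (Ioi t) t := by
  obtain ⟨C, hC, hlim⟩ := h.1 ht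
  rw [hasDerivWithinAt_iff_tendsto_slope' (by simp)]
  have hlim' := ((continuous_supportFn_left u).tendsto D).comp hlim
  have hsub : Tendsto (fun s => s - t) (𝓝[>] t) (𝓝[>] 0) := by
    refine tendsto_nhdsWithin_iff.2 ⟨?_, ?_⟩
    · exact (Continuous.tendsto' (by fun_prop) _ _ (by simp)).mono_left nhdsWithin_le_nhds
    · filter_upwards [self_mem_nhdsWithin] with s hs
      simpa using hs
  refine (hlim'.comp hsub).congr' ?_
  filter_upwards [hsub.eventually hC, self_mem_nhdsWithin] with s hs hst
  have hst' : 0 < s - t := sub_pos.2 hst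
  have : F s = F t + C (s - t) := by simpa [IsHukuharaDiff] using hs
  simp [slope_def_field, this, supportFn_add, supportFn_smul (inv_nonneg.2 hst'.le),
    div_eq_inv_mul]

theorem HasHukuharaDerivAt.hasDerivWithinAt_supportFn_Iio {T t : ℝ} {F : ℝ → ConvexBody E}
    {D : ConvexBody E} (h : HasHukuharaDerivAt T F D t) (ht : 0 < t) (u : E) :
    HasDerivWithinAt (fun s => supportFn (F s) u) (supportFn D u) (Iio t) t := by
  obtain ⟨C, hC, hlim⟩ := h.2 ht
  rw [hasDerivWithinAt_iff_tendsto_slope' (by simp)]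
  have hlim' := ((continuous_supportFn_left u).tendsto D).comp hlim
  have hsub : Tendsto (fun s => t - s) (𝓝[<] t) (𝓝[>] 0) := by
    refine tendsto_nhdsWithin_iff.2 ⟨?_, ?_⟩
    · exact (Continuous.tendsto' (by fun_prop) _ _ (by simp)).mono_left nhdsWithin_le_nhds
    · filter_upwards [self_mem_nhdsWithin] with s hs
      simpa using hs
  refine (hlim'.comp hsub).congr' ?_
  filter_upwards [hsub.eventually hC, self_mem_nhdsWithin] with s hs hst
  have hst' : 0 < t - s := sub_pos.2 hst
  have : F t = F s + C (t - s) := by simpa [IsHukuharaDiff] using hs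
  rw [slope_comm]
  simp [slope_def_field, this, supportFn_add, supportFn_smul (inv_nonneg.2 hst'.le),
    div_eq_inv_mul]

variable {T : ℝ} {F : ℝ → ConvexBody E}

theorem HukuharaDifferentiable.hasDerivAt_supportFn (hF : HukuharaDifferentiable T F) {t : ℝ}
    (ht : t ∈ Ioo 0 T) (u : E) :
    HasDerivAt (fun s => supportFn (F s) u) (supportFn (hukuharaDeriv T F t) u) t := by
  have h := hF.hasHukuharaDerivAt (Ioo_subset_Icc_self ht)
  have h1 := ((h.hasDerivWithinAt_supportFn_Iio ht.1 u).Iic_of_Iio).union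
    ((h.hasDerivWithinAt_supportFn_Ioi ht.2 u).Ici_of_Ioi)
  rwa [Iic_union_Ici, hasDerivWithinAt_univ] at h1

theorem HukuharaDifferentiable.continuousOn_supportFn (hF : HukuharaDifferentiable T F) (u : E) :
    ContinuousOn (fun s => supportFn (F s) u) (Icc 0 T) := by
  intro t ht
  have h := hF.hasHukuharaDerivAt ht
  have hl : ContinuousWithinAt (fun s => supportFn (F s) u) (Icc 0 t) t := by
    rcases ht.1.eq_or_lt with rfl | h0
    · simp
    · exact (h.hasDerivWithinAt_supportFn_Iio h0 u).Iic_of_Iio.continuousWithinAt.mono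
        Icc_subset_Iic_self
  have hr : ContinuousWithinAt (fun s => supportFn (F s) u) (Icc t T) t := by
    rcases ht.2.eq_or_lt with rfl | h0
    · simp
    · exact (h.hasDerivWithinAt_supportFn_Ioi h0 u).Ici_of_Ioi.continuousWithinAt.mono
        Icc_subset_Ici_self
  have := hl.union hr
  rwa [Icc_union_Icc_eq_Icc ht.1 ht.2] at this

theorem setNorm_hukuharaDeriv_le (hB : BddAbove (derivNorms T F)) {t : ℝ} (ht : t ∈ Icc 0 T) :
    setNorm (hukuharaDeriv T F t) ≤ sSup (derivNorms T F) :=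
  le_csSup hB ⟨t, ht, rfl⟩

theorem sSup_derivNorms_nonneg (T : ℝ) (F : ℝ → ConvexBody E) : 0 ≤ sSup (derivNorms T F) := by
  refine Real.sSup_nonneg ?_
  rintro _ ⟨t, _, rfl⟩
  exact setNorm_nonneg _

theorem ae_restrict_Icc_mem_Ioo (a b : ℝ) : ∀ᵐ t ∂volume.restrict (Icc a b), t ∈ Ioo a b := by
  rw [← restrict_Ioo_eq_restrict_Icc]
  exact ae_restrict_mem measurableSet_Ioo

theorem HukuharaDifferentiable.aestronglyMeasurable_hukuharaDeriv [ProperSpace E]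
    (hF : HukuharaDifferentiable T F) :
    AEStronglyMeasurable (hukuharaDeriv T F) (volume.restrict (Icc 0 T)) := by
  classical
  -- On the open interval each support function of `D` is a two-sided derivative, and `deriv` is
  -- always Borel measurable. The endpoints form a null set.
  let D : ℝ → ConvexBody E := fun s => if s ∈ Ioo 0 T then hukuharaDeriv T F s else 0
  have hD : StronglyMeasurable D := by
    refine stronglyMeasurable_of_measurable_supportFn fun u => ?_
    have he : (fun s => supportFn (D s) u) = fun s =>
        if s ∈ Ioo 0 T then deriv (fun s => supportFn (F s) u) s
        else supportFn (0 : ConvexBody E) u := by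
      ext s
      by_cases hs : s ∈ Ioo 0 T
      · simp only [D, if_pos hs]
        exact (hF.hasDerivAt_supportFn hs u).deriv.symm
      · simp only [D, if_neg hs]
    rw [he]
    exact Measurable.ite measurableSet_Ioo (measurable_deriv _) measurable_const
  refine ⟨D, hD, ?_⟩
  filter_upwards [ae_restrict_Icc_mem_Ioo 0 T] with s hs
  simp only [D, if_pos hs]

theorem intervalIntegrable_of_norm_le {G : Type*} [NormedAddCommGroup G] {φ : ℝ → G} {L T s t : ℝ}
    (hm : AEStronglyMeasurable φ (volume.restrict (Icc 0 T)))
    (hb : ∀ᵐ x ∂volume.restrict (Icc 0 T), ‖φ x‖ ≤ L) (hs : s ∈ Icc 0 T) (ht : t ∈ Icc 0 T) :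
    IntervalIntegrable φ volume s t := by
  rw [intervalIntegrable_iff]
  have h : IntegrableOn φ (Icc 0 T) volume :=
    Integrable.of_bound hm L hb
  exact h.mono_set (uIoc_subset_uIcc.trans (uIcc_subset_Icc hs ht))

theorem norm_integral_le_of_ae_le {G : Type*} [NormedAddCommGroup G] [NormedSpace ℝ G] {φ : ℝ → G}
    {L T s t : ℝ} (hb : ∀ᵐ x ∂volume.restrict (Icc 0 T), ‖φ x‖ ≤ L) (hs : s ∈ Icc 0 T)
    (ht : t ∈ Icc 0 T) : ‖∫ x in s..t, φ x‖ ≤ L * |t - s| := by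
  refine intervalIntegral.norm_integral_le_of_norm_le_const_ae ?_
  rw [ae_restrict_iff' measurableSet_Icc] at hb
  filter_upwards [hb] with x hx hx'
  exact hx (uIcc_subset_Icc hs ht (uIoc_subset_uIcc hx'))

theorem HukuharaDifferentiable.integral_supportFn [ProperSpace E]
    (hF : HukuharaDifferentiable T F) (hB : BddAbove (derivNorms T F)) {t : ℝ}
    (ht : t ∈ Icc 0 T) (u : E) :
    IntervalIntegrable (fun s => supportFn (hukuharaDeriv T F s) u) volume 0 t ∧
    ∫ s in (0 : ℝ)..t, supportFn (hukuharaDeriv T F s) u =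
      supportFn (F t) u - supportFn (F 0) u := by
  have hi : IntervalIntegrable (fun s => supportFn (hukuharaDeriv T F s) u) volume 0 t := by
    refine intervalIntegrable_of_norm_le (T := T) (L := sSup (derivNorms T F) * ‖u‖)
      ((continuous_supportFn_left u).comp_aestronglyMeasurable
        hF.aestronglyMeasurable_hukuharaDeriv) ?_ ⟨le_rfl, ht.1.trans ht.2⟩ ht
    filter_upwards [ae_restrict_mem measurableSet_Icc] with s hs
    exact (abs_supportFn_le _ u).trans (by gcongr; exact setNorm_hukuharaDeriv_le hB hs)
  refine ⟨hi, intervalIntegral.integral_eq_sub_of_hasDerivAt_of_le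
    (f := fun s => supportFn (F s) u) ht.1
    ((hF.continuousOn_supportFn u).mono (Icc_subset_Icc_right ht.2))
    (fun x hx => hF.hasDerivAt_supportFn ⟨hx.1, hx.2.trans_le ht.2⟩ u) hi⟩

variable {φ : ℝ → E} {a : E}

theorem ae_norm_le_of_ae_mem (hB : BddAbove (derivNorms T F))
    (hmem : ∀ᵐ s ∂volume.restrict (Icc 0 T), φ s ∈ hukuharaDeriv T F s) :
    ∀ᵐ s ∂volume.restrict (Icc 0 T), ‖φ s‖ ≤ sSup (derivNorms T F) := by
  filter_upwards [hmem, ae_restrict_mem measurableSet_Icc] with s hs hs'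
  exact (norm_le_setNorm hs).trans (setNorm_hukuharaDeriv_le hB hs')

/-- In each direction `u` the fundamental theorem of calculus bounds the inner product by `supportFn
(F 0) u + ∫ supportFn (D_H F) u = supportFn (F t) u`; separation then gives membership. -/
theorem add_integral_mem [ProperSpace E] (hF : HukuharaDifferentiable T F)
    (hB : BddAbove (derivNorms T F))
    (ha : a ∈ F 0) (hm : AEStronglyMeasurable φ (volume.restrict (Icc 0 T)))
    (hmem : ∀ᵐ s ∂volume.restrict (Icc 0 T), φ s ∈ hukuharaDeriv T F s) {t : ℝ}
    (ht : t ∈ Icc 0 T) : a + ∫ s in (0 : ℝ)..t, φ s ∈ F t := by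
  have hφ : IntervalIntegrable φ volume 0 t :=
    intervalIntegrable_of_norm_le hm (ae_norm_le_of_ae_mem hB hmem) ⟨le_rfl, ht.1.trans ht.2⟩ ht
  refine mem_of_forall_inner_le fun u => ?_
  obtain ⟨hi, he⟩ := hF.integral_supportFn hB ht u
  have h1 : inner ℝ (∫ s in (0 : ℝ)..t, φ s) u = ∫ s in (0 : ℝ)..t, inner ℝ (φ s) u := by
    simp_rw [real_inner_comm u]
    exact ((innerSL ℝ u).intervalIntegral_comp_comm hφ).symm
  have h2 : ∫ s in (0 : ℝ)..t, inner ℝ (φ s) u ≤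
      ∫ s in (0 : ℝ)..t, supportFn (hukuharaDeriv T F s) u := by
    refine intervalIntegral.integral_mono_ae_restrict ht.1 ?_ hi ?_
    · simp_rw [real_inner_comm u]
      exact intervalIntegrable_iff.2 ((intervalIntegrable_iff.1 hφ).const_inner u)
    · filter_upwards [ae_restrict_of_ae_restrict_of_subset (Icc_subset_Icc_right ht.2) hmem]
        with s hs
      exact inner_le_supportFn hs u
  rw [inner_add_left, h1]
  linarith [inner_le_supportFn ha u]

theorem IsPartition.sum_sub {a b : ℝ} {n : ℕ} {u : ℕ → ℝ} (h : IsPartition a b n u) :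
    ∑ i ∈ Finset.range n, (u (i + 1) - u i) = b - a := by
  rw [Finset.sum_range_sub, h.left, h.right]

theorem IsPartition.mono {a b : ℝ} {n : ℕ} {u : ℕ → ℝ} (h : IsPartition a b n u) {i j : ℕ}
    (hij : i ≤ j) (hj : j ≤ n) : u i ≤ u j := by
  induction j, hij using Nat.le_induction with
  | base => exact le_rfl
  | succ k hk ih => exact (ih (by omega)).trans (h.lt k (by omega)).le

theorem IsPartition.mem_Icc {a b : ℝ} {n : ℕ} {u : ℕ → ℝ} (h : IsPartition a b n u) {i : ℕ}
    (hi : i ≤ n) : u i ∈ Icc a b :=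
  ⟨h.left ▸ h.mono (Nat.zero_le i) hi, h.right ▸ h.mono hi le_rfl⟩

theorem memBV_of_lipschitz {G : Type*} [NormedAddCommGroup G] {f : ℝ → G}
    {L p T : ℝ} (hL : 0 ≤ L) (hp : 1 < p)
    (hf : ∀ s ∈ Icc 0 T, ∀ t ∈ Icc 0 T, dist (f s) (f t) ≤ L * |t - s|) : MemBV p T f := by
  refine lt_of_le_of_lt (b := ENNReal.ofReal (L ^ p * T)) ?_ ENNReal.ofReal_lt_top
  refine iSup_le fun n => iSup_le fun u => iSup_le fun hu => ?_
  have hterm : ∀ i ∈ Finset.range n,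
      dist (f (u i)) (f (u (i + 1))) ^ p / (u (i + 1) - u i) ^ (p - 1) ≤
        L ^ p * (u (i + 1) - u i) := by
    intro i hi
    rw [Finset.mem_range] at hi
    have hpos : 0 < u (i + 1) - u i := sub_pos.2 (hu.lt i hi)
    have h := hf _ (hu.mem_Icc hi.le) _ (hu.mem_Icc hi)
    rw [abs_of_pos hpos] at h
    rw [div_le_iff₀ (by positivity), mul_assoc, ← Real.rpow_one_add' hpos.le (by linarith),
      add_sub_cancel, ← Real.mul_rpow hL hpos.le]
    exact Real.rpow_le_rpow dist_nonneg h (by linarith)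
  rw [← ENNReal.ofReal_sum_of_nonneg]
  · refine ENNReal.ofReal_le_ofReal ((Finset.sum_le_sum hterm).trans ?_)
    rw [← Finset.mul_sum, hu.sum_sub, sub_zero]
  · intro i hi
    have hpos : 0 < u (i + 1) - u i := sub_pos.2 (hu.lt i (Finset.mem_range.1 hi))
    positivity

/-- Bounded `φ` makes the primitive Lipschitz, hence of finite Riesz variation; Lebesgue
differentiation recovers `φ` almost everywhere. -/
theorem add_integral_mem_IS [ProperSpace E] {p : ℝ} (hT : 0 < T) (hp : 1 < p)
    (hF : HukuharaDifferentiable T F) (hB : BddAbove (derivNorms T F)) (ha : a ∈ F 0)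
    (hm : AEStronglyMeasurable φ (volume.restrict (Icc 0 T)))
    (hmem : ∀ᵐ s ∂volume.restrict (Icc 0 T), φ s ∈ hukuharaDeriv T F s) :
    (fun t => a + ∫ s in (0 : ℝ)..t, φ s) ∈ IS p T F := by
  have hb := ae_norm_le_of_ae_mem hB hmem
  have h0 : (0 : ℝ) ∈ Icc 0 T := ⟨le_rfl, hT.le⟩
  have hφ : ∀ t ∈ Icc 0 T, IntervalIntegrable φ volume 0 t := fun t ht =>
    intervalIntegrable_of_norm_le hm hb h0 ht
  have hd : ∀ᵐ t ∂volume.restrict (Icc 0 T),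
      HasDerivAt (fun t => a + ∫ s in (0 : ℝ)..t, φ s) (φ t) t := by
    rw [ae_restrict_iff' measurableSet_Icc]
    filter_upwards [(hφ T ⟨hT.le, le_rfl⟩).ae_hasDerivAt_integral] with t ht htT
    rw [uIcc_of_le hT.le] at ht
    exact (ht htT 0 h0).const_add a
  have hde : deriv (fun t => a + ∫ s in (0 : ℝ)..t, φ s) =ᵐ[volume.restrict (Icc 0 T)] φ := by
    filter_upwards [hd] with t ht using ht.deriv
  refine ⟨?_, fun t ht => add_integral_mem hF hB ha hm hmem ht, ?_, ?_⟩
  · refine memBV_of_lipschitz (sSup_derivNorms_nonneg T F) hp fun s hs t ht => ?_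
    rw [dist_comm, dist_add_left, dist_eq_norm,
      intervalIntegral.integral_interval_sub_left (hφ t ht) (hφ s hs)]
    exact norm_integral_le_of_ae_le hb hs ht
  · exact (MemLp.of_bound hm _ hb).ae_eq hde.symm
  · filter_upwards [hd, hmem] with t ht htm
    exact ⟨ht.differentiableAt, by rwa [ht.deriv]⟩

end Hukuhara

/-! ### Finite Riesz variation implies absolute continuity. -/

section RieszVariation

theorem IsPartition.exists_append {a b c : ℝ} {n : ℕ} {u : ℕ → ℝ} (h : IsPartition a b n u)
    (hbc : b < c) (w : ℝ → ℝ → ℝ) : ∃ v, IsPartition a c (n + 1) v ∧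
      ∑ i ∈ Finset.range (n + 1), w (v i) (v (i + 1)) =
        ∑ i ∈ Finset.range n, w (u i) (u (i + 1)) + w b c := by
  refine ⟨fun i => if i ≤ n then u i else c, ⟨?_, ?_, fun i hi => ?_⟩, ?_⟩
  · simpa using h.left
  · simp
  · rcases (Nat.lt_succ_iff.1 hi).eq_or_lt with rfl | hi'
    · simpa [h.right] using hbc
    · simpa [hi'.le, Nat.succ_le_of_lt hi'] using h.lt i hi'
  · rw [Finset.sum_range_succ]
    congr 1
    · refine Finset.sum_congr rfl fun i hi => ?_
      rw [Finset.mem_range] at hi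
      simp [hi.le, Nat.succ_le_of_lt hi]
    · simp [h.right]

/-- Disjointness puts the interval with the largest right end after all the others, so it can be
appended last. Filling the gaps only adds nonnegative terms. -/
theorem exists_partition_sum_le {ι : Type*} {a : ℝ} {l r : ι → ℝ} {w : ℝ → ℝ → ℝ}
    (hw : ∀ s t, s < t → 0 ≤ w s t) (S : Finset ι) {x : ℝ} (hx : a ≤ x)
    (hl : ∀ i ∈ S, a ≤ l i) (hlr : ∀ i ∈ S, l i < r i) (hr : ∀ i ∈ S, r i ≤ x)
    (hd : (S : Set ι).PairwiseDisjoint fun i => Ioc (l i) (r i)) :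
    ∃ n u, IsPartition a x n u ∧
      ∑ i ∈ S, w (l i) (r i) ≤ ∑ i ∈ Finset.range n, w (u i) (u (i + 1)) := by
  classical
  induction S using Finset.induction_on_max_value r generalizing x with
  | empty =>
    have h0 : IsPartition a a 0 fun _ => a := ⟨rfl, rfl, by simp⟩
    rcases hx.eq_or_lt with rfl | hx
    · exact ⟨0, _, h0, by simp⟩
    · obtain ⟨v, hv, hs⟩ := h0.exists_append hx w
      exact ⟨_, v, hv, by rw [hs]; simpa using hw _ _ hx⟩
  | insert i S hi hmax ih =>
    have hri : ∀ j ∈ S, r j ≤ l i := by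
      intro j hj
      by_contra! hlt
      have hij : j ≠ i := fun h => hi (h ▸ hj)
      exact Set.disjoint_left.1 (hd (by simp [hj]) (by simp) hij)
        ⟨hlr j (by simp [hj]), le_rfl⟩ ⟨hlt, hmax j hj⟩
    obtain ⟨n, u, hu, hs⟩ := ih (hl i (by simp)) (fun j hj => hl j (by simp [hj]))
      (fun j hj => hlr j (by simp [hj])) hri (hd.subset (by simp))
    obtain ⟨v, hv, hvs⟩ := hu.exists_append (hlr i (by simp)) w
    have hsum : ∑ j ∈ insert i S, w (l j) (r j) ≤
        ∑ k ∈ Finset.range (n + 1), w (v k) (v (k + 1)) := by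
      rw [Finset.sum_insert hi, hvs]
      linarith
    rcases (hr i (by simp)).eq_or_lt with h | h
    · exact ⟨_, v, h ▸ hv, hsum⟩
    · obtain ⟨v', hv', hvs'⟩ := hv.exists_append h w
      exact ⟨_, v', hv', by rw [hvs']; linarith [hw _ _ h]⟩

variable {E : Type*} [NormedAddCommGroup E]

theorem MemBV.sum_le {ι : Type*} {p T : ℝ} {f : ℝ → E} (hf : MemBV p T f) (hT : 0 ≤ T)
    {l r : ι → ℝ} (S : Finset ι) (hl : ∀ i ∈ S, 0 ≤ l i) (hlr : ∀ i ∈ S, l i < r i)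
    (hr : ∀ i ∈ S, r i ≤ T) (hd : (S : Set ι).PairwiseDisjoint fun i => Ioc (l i) (r i)) :
    ∑ i ∈ S, dist (f (l i)) (f (r i)) ^ p / (r i - l i) ^ (p - 1) ≤
      (rieszVariation p T f).toReal := by
  have hw : ∀ s t, s < t → 0 ≤ dist (f s) (f t) ^ p / (t - s) ^ (p - 1) := by
    intro s t hst
    have : 0 < t - s := sub_pos.2 hst
    positivity
  obtain ⟨n, u, hu, hs⟩ := exists_partition_sum_le hw S hT hl hlr hr hd
  refine hs.trans ((ENNReal.ofReal_le_iff_le_toReal hf.ne).1 ?_)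
  rw [ENNReal.ofReal_sum_of_nonneg fun i hi => hw _ _ (hu.lt i (Finset.mem_range.1 hi))]
  exact le_iSup_of_le n (le_iSup_of_le u (le_iSup_of_le hu le_rfl))

/-- Either the slope `d / ℓ` is at most `K`, or `d ≤ d * (d / (K * ℓ)) ^ (p - 1)`. -/
theorem le_mul_add_rpow_div {p d ℓ K : ℝ} (hp : 1 < p) (hd : 0 ≤ d) (hℓ : 0 < ℓ) (hK : 0 < K) :
    d ≤ K * ℓ + (d ^ p / ℓ ^ (p - 1)) / K ^ (p - 1) := by
  rcases le_or_gt d (K * ℓ) with h | h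
  · exact h.trans (le_add_of_nonneg_right (by positivity))
  · have hd' : 0 < d := lt_trans (by positivity) h
    have h1 : d ≤ (d ^ p / ℓ ^ (p - 1)) / K ^ (p - 1) := by
      rw [div_div, ← Real.mul_rpow hℓ.le hK.le, le_div_iff₀ (by positivity)]
      calc d * (ℓ * K) ^ (p - 1) ≤ d * d ^ (p - 1) := by
            gcongr
            linarith
        _ = d ^ p := by
            rw [← Real.rpow_one_add' hd (by linarith), add_sub_cancel]
    exact h1.trans (le_add_of_nonneg_left (by positivity))

theorem MemBV.absolutelyContinuousOnInterval {p T : ℝ} {f : ℝ → E} (hf : MemBV p T f)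
    (hp : 1 < p) (hT : 0 ≤ T) : AbsolutelyContinuousOnInterval f 0 T := by
  rw [absolutelyContinuousOnInterval_iff]
  intro ε hε
  set V := (rieszVariation p T f).toReal with hV
  have hV0 : 0 ≤ V := ENNReal.toReal_nonneg
  -- With `K ^ (p - 1) = B`, steep intervals contribute at most `V / B < ε / 2`; the others
  -- contribute at most `K` times their total length.
  set B := 2 * V / ε + 1 with hB
  have hB0 : 0 < B := by positivity
  set K := B ^ (1 / (p - 1)) with hK
  have hK0 : 0 < K := by positivity
  have hKp : K ^ (p - 1) = B := by
    rw [hK, ← Real.rpow_mul hB0.le, one_div_mul_cancel (by linarith), Real.rpow_one]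
  have hVB : V / B < ε / 2 := by
    rw [div_lt_iff₀ hB0, hB]
    have : ε / 2 * (2 * V / ε + 1) = V + ε / 2 := by field_simp
    linarith
  refine ⟨ε / (2 * K), by positivity, fun I hI hlen => ?_⟩
  rw [AbsolutelyContinuousOnInterval.disjWithin, mem_ofPred_eq, uIcc_of_le hT] at hI
  obtain ⟨hI1, hI2⟩ := hI
  set l : ℕ → ℝ := fun i => min (I.2 i).1 (I.2 i).2 with hl
  set r : ℕ → ℝ := fun i => max (I.2 i).1 (I.2 i).2 with hr
  -- Degenerate intervals contribute zero but cannot occur in a partition, so they are dropped.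
  set S := (Finset.range I.1).filter fun i => l i < r i with hS
  have hdl : ∀ i, dist (f (I.2 i).1) (f (I.2 i).2) = dist (f (l i)) (f (r i)) := by
    intro i
    rcases le_total (I.2 i).1 (I.2 i).2 with h | h
    · simp [hl, hr, h]
    · simp [hl, hr, h, dist_comm]
  have hdist : ∀ i, dist (I.2 i).1 (I.2 i).2 = r i - l i := fun i => by
    rw [Real.dist_eq, max_sub_min_eq_abs']
  have hsum := hf.sum_le hT (l := l) (r := r) S
    (fun i hi => le_min (hI1 i (Finset.mem_filter.1 hi).1).1.1 (hI1 i (Finset.mem_filter.1 hi).1).2.1)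
    (fun i hi => (Finset.mem_filter.1 hi).2)
    (fun i hi => max_le (hI1 i (Finset.mem_filter.1 hi).1).1.2 (hI1 i (Finset.mem_filter.1 hi).1).2.2)
    (hI2.subset (by exact_mod_cast Finset.filter_subset _ _))
  have hzero : ∀ i ∈ Finset.range I.1, i ∉ S → dist (f (l i)) (f (r i)) = 0 := by
    intro i hi his
    have : ¬ l i < r i := fun h => his (Finset.mem_filter.2 ⟨hi, h⟩)
    have hle : l i ≤ r i := min_le_max
    rw [le_antisymm hle (not_lt.1 this), dist_self]
  calc ∑ i ∈ Finset.range I.1, dist (f (I.2 i).1) (f (I.2 i).2)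
      = ∑ i ∈ S, dist (f (l i)) (f (r i)) := by
        simp_rw [hdl]
        exact (Finset.sum_subset (Finset.filter_subset _ _) hzero).symm
    _ ≤ ∑ i ∈ S, (K * (r i - l i) +
          (dist (f (l i)) (f (r i)) ^ p / (r i - l i) ^ (p - 1)) / B) := by
        refine Finset.sum_le_sum fun i hi => ?_
        rw [← hKp]
        exact le_mul_add_rpow_div hp dist_nonneg (sub_pos.2 (Finset.mem_filter.1 hi).2) hK0
    _ = K * ∑ i ∈ S, (r i - l i) +
          (∑ i ∈ S, dist (f (l i)) (f (r i)) ^ p / (r i - l i) ^ (p - 1)) / B := by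
        rw [Finset.sum_add_distrib, ← Finset.mul_sum, ← Finset.sum_div]
    _ ≤ K * ∑ i ∈ Finset.range I.1, dist (I.2 i).1 (I.2 i).2 + V / B := by
        simp_rw [hdist]
        gcongr with i hi
        · exact fun i _ _ => sub_nonneg.2 min_le_max
        · exact Finset.filter_subset _ _
    _ < K * (ε / (2 * K)) + ε / 2 := by gcongr
    _ = ε := by field_simp; norm_num

/-- The difference of `f` and the primitive of `deriv f` is absolutely continuous with derivative
zero almost everywhere, hence constant. -/
theorem MemBV.eq_add_integral_deriv [NormedSpace ℝ E] [CompleteSpace E] {p T L : ℝ} {f : ℝ → E}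
    (hf : MemBV p T f) (hp : 1 < p) (hT : 0 < T)
    (hm : AEStronglyMeasurable (deriv f) (volume.restrict (Icc 0 T)))
    (hdiff : ∀ᵐ t ∂volume.restrict (Icc 0 T), DifferentiableAt ℝ f t)
    (hb : ∀ᵐ t ∂volume.restrict (Icc 0 T), ‖deriv f t‖ ≤ L) {x : ℝ} (hx : x ∈ Icc 0 T) :
    f x = f 0 + ∫ s in (0 : ℝ)..x, deriv f s := by
  have h0 : (0 : ℝ) ∈ Icc 0 T := ⟨le_rfl, hT.le⟩
  have hi : ∀ t ∈ Icc 0 T, IntervalIntegrable (deriv f) volume 0 t := fun t ht =>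
    intervalIntegrable_of_norm_le hm hb h0 ht
  have hlip : LipschitzOnWith L.toNNReal (fun t => ∫ s in (0 : ℝ)..t, deriv f s) (uIcc 0 T) := by
    rw [uIcc_of_le hT.le]
    refine LipschitzOnWith.of_dist_le_mul fun s hs t ht => ?_
    rw [dist_comm, dist_eq_norm,
      intervalIntegral.integral_interval_sub_left (hi t ht) (hi s hs), dist_comm s t,
      Real.dist_eq]
    refine (norm_integral_le_of_ae_le hb hs ht).trans ?_
    gcongr
    exact Real.le_coe_toNNReal L
  have hac := (hf.absolutelyContinuousOnInterval hp hT.le).sub hlip.absolutelyContinuousOnInterval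
  rw [ae_restrict_iff' measurableSet_Icc] at hdiff
  obtain ⟨c, hc⟩ := hac.const_of_ae_hasDerivAt_zero (by
    filter_upwards [hdiff, (hi T ⟨hT.le, le_rfl⟩).ae_hasDerivAt_integral] with t h1 h2 ht
    rw [uIcc_of_le hT.le] at ht h2
    simpa using (h1 ht).hasDerivAt.sub (h2 ht 0 h0))
  rw [uIcc_of_le hT.le] at hc
  have e1 := hc x hx
  have e2 := hc 0 h0
  simp only [Pi.sub_apply, intervalIntegral.integral_same, sub_zero] at e1 e2
  rw [e2, ← e1]
  abel

end RieszVariation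

/-! ### The Young integral by integration by parts. -/

section Young

variable {α T : ℝ} {g : ℝ → ℝ}

theorem holderConst_nonneg (α T : ℝ) (g : ℝ → ℝ) : 0 ≤ holderConst α T g := by
  refine Real.sSup_nonneg ?_
  rintro _ ⟨s, t, _, hst, _, rfl⟩
  have : 0 < t - s := sub_pos.2 hst
  positivity

theorem IsHolder.abs_sub_le (hg : IsHolder α T g) {s t : ℝ} (hs : 0 ≤ s) (hst : s ≤ t)
    (ht : t ≤ T) : |g t - g s| ≤ holderConst α T g * (t - s) ^ α := by
  rcases hst.eq_or_lt with rfl | hst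
  · simpa using mul_nonneg (holderConst_nonneg α T g) (Real.rpow_nonneg le_rfl α)
  · have h : 0 < t - s := sub_pos.2 hst
    rw [← div_le_iff₀ (by positivity)]
    exact le_csSup hg ⟨s, t, hs, hst, ht, rfl⟩

theorem IsHolder.continuousOn (hg : IsHolder α T g) (hα : 0 < α) : ContinuousOn g (Icc 0 T) := by
  intro t ht
  rw [ContinuousWithinAt, tendsto_iff_dist_tendsto_zero]
  have hlim : Tendsto (fun s => holderConst α T g * |s - t| ^ α) (𝓝[Icc 0 T] t) (𝓝 0) := by
    refine (Continuous.tendsto' ?_ _ _ ?_).mono_left nhdsWithin_le_nhds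
    · exact continuous_const.mul ((continuous_abs.comp (continuous_id.sub continuous_const)).rpow_const
        fun _ => Or.inr hα.le)
    · simp [Real.zero_rpow hα.ne']
  refine squeeze_zero' (Eventually.of_forall fun _ => dist_nonneg) ?_ hlim
  filter_upwards [self_mem_nhdsWithin] with s hs
  rcases le_total s t with h | h
  · rw [dist_comm, Real.dist_eq, abs_sub_comm s t, abs_of_nonneg (sub_nonneg.2 h)]
    exact hg.abs_sub_le hs.1 h ht.2
  · rw [Real.dist_eq, abs_of_nonneg (sub_nonneg.2 h)]
    exact hg.abs_sub_le ht.1 h hs.2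

variable {E : Type*} [NormedAddCommGroup E] [NormedSpace ℝ E]

/-- The value of the Young integral over `[0, t]` of the function with initial value `a` and
derivative `φ`, obtained by integration by parts. -/
def youngValue (g : ℝ → ℝ) (a : E) (φ : ℝ → E) (t : ℝ) : E :=
  (g t - g 0) • a + ∫ s in (0 : ℝ)..t, (g t - g s) • φ s

variable {φ : ℝ → E} {L : ℝ}

theorem intervalIntegrable_sub_smul (hg : ContinuousOn g (Icc 0 T))
    (hφ : ∀ s ∈ Icc 0 T, ∀ t ∈ Icc 0 T, IntervalIntegrable φ volume s t) (c : ℝ) {x y : ℝ}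
    (hx : x ∈ Icc 0 T) (hy : y ∈ Icc 0 T) :
    IntervalIntegrable (fun s => (c - g s) • φ s) volume x y :=
  (hφ x hx y hy).continuousOn_smul
    ((continuousOn_const.sub hg).mono (uIcc_subset_Icc hx hy))

/-- The first summand is exactly the left-point Riemann term on `[x, y]`, so the remaining integral
is the error of that term. -/
theorem youngValue_sub (hg : ContinuousOn g (Icc 0 T))
    (hφ : ∀ s ∈ Icc 0 T, ∀ t ∈ Icc 0 T, IntervalIntegrable φ volume s t) (a : E) {x y : ℝ}
    (hx : x ∈ Icc 0 T) (hy : y ∈ Icc 0 T) :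
    youngValue g a φ y - youngValue g a φ x = (g y - g x) • (a + ∫ s in (0 : ℝ)..x, φ s) +
      ∫ s in x..y, (g y - g s) • φ s := by
  have h0 : (0 : ℝ) ∈ Icc 0 T := ⟨le_rfl, hx.1.trans hx.2⟩
  have h1 := intervalIntegral.integral_add_adjacent_intervals
    (intervalIntegrable_sub_smul hg hφ (g y) h0 hx) (intervalIntegrable_sub_smul hg hφ (g y) hx hy)
  have h2 : ∫ s in (0 : ℝ)..x, (g y - g s) • φ s =
      (g y - g x) • (∫ s in (0 : ℝ)..x, φ s) + ∫ s in (0 : ℝ)..x, (g x - g s) • φ s := by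
    rw [← intervalIntegral.integral_smul, ← intervalIntegral.integral_add
      (f := fun s => (g y - g x) • φ s) ((hφ 0 h0 x hx).smul (g y - g x))
      (intervalIntegrable_sub_smul hg hφ (g x) h0 hx)]
    refine intervalIntegral.integral_congr fun s _ => ?_
    simp only [← add_smul, sub_add_sub_cancel]
  rw [youngValue, youngValue, ← h1, h2, smul_add, sub_smul, sub_smul, sub_smul]
  simp only [sub_smul]
  abel

/-- On each cell the error is at most `M * L * mesh ^ α` times the cell length, and the lengths sum
to `t`. -/
theorem hasYoungIntegral_youngValue (hT : 0 < T) (hα : 0 < α) (hg : IsHolder α T g)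
    (hm : AEStronglyMeasurable φ (volume.restrict (Icc 0 T)))
    (hb : ∀ᵐ t ∂volume.restrict (Icc 0 T), ‖φ t‖ ≤ L) (hL : 0 ≤ L) {f : ℝ → E} {a : E}
    (hf : ∀ x ∈ Icc 0 T, f x = a + ∫ s in (0 : ℝ)..x, φ s) {t : ℝ} (ht : t ∈ Icc 0 T) :
    HasYoungIntegral f g 0 t (youngValue g a φ t) := by
  have hφ : ∀ s ∈ Icc 0 T, ∀ t ∈ Icc 0 T, IntervalIntegrable φ volume s t := fun s hs t ht =>
    intervalIntegrable_of_norm_le hm hb hs ht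
  have hgc := hg.continuousOn hα
  set M := holderConst α T g with hM
  have hM0 : 0 ≤ M := holderConst_nonneg α T g
  intro ε hε
  -- `c` bounds `mesh ^ α`; the `+ 1` covers the case where `M` or `L` vanishes and makes the final
  -- inequality strict.
  set c := ε / (M * L * T + 1) with hc
  have hc0 : 0 < c := by positivity
  refine ⟨c ^ (1 / α), by positivity, fun n u hu hmesh => ?_⟩
  have hmem : ∀ i ≤ n, u i ∈ Icc 0 T := fun i hi =>
    ⟨(hu.mem_Icc hi).1, (hu.mem_Icc hi).2.trans ht.2⟩
  have htel : youngValue g a φ t =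
      ∑ i ∈ Finset.range n, (youngValue g a φ (u (i + 1)) - youngValue g a φ (u i)) := by
    rw [Finset.sum_range_sub (fun i => youngValue g a φ (u i)), hu.left, hu.right]
    simp [youngValue]
  have hterm : ∀ i ∈ Finset.range n, ‖(g (u (i + 1)) - g (u i)) • f (u i) -
      (youngValue g a φ (u (i + 1)) - youngValue g a φ (u i))‖ ≤
        M * c * L * (u (i + 1) - u i) := by
    intro i hi
    rw [Finset.mem_range] at hi
    have hlt := hu.lt i hi
    rw [youngValue_sub hgc hφ a (hmem i hi.le) (hmem (i + 1) hi), hf _ (hmem i hi.le),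
      sub_add_cancel_left, norm_neg, ← abs_of_pos (sub_pos.2 hlt)]
    refine intervalIntegral.norm_integral_le_of_norm_le_const_ae ?_
    rw [ae_restrict_iff' measurableSet_Icc] at hb
    filter_upwards [hb] with s hs hs'
    rw [uIoc_of_le hlt.le] at hs'
    have hs0 : 0 ≤ s := (hmem i hi.le).1.trans hs'.1.le
    rw [norm_smul, Real.norm_eq_abs]
    refine mul_le_mul ?_ (hs ⟨hs0, hs'.2.trans (hmem _ hi).2⟩) (norm_nonneg _) (by positivity)
    refine (hg.abs_sub_le hs0 hs'.2 (hmem _ hi).2).trans ?_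
    gcongr
    calc (u (i + 1) - s) ^ α ≤ (c ^ (1 / α)) ^ α := by
          refine Real.rpow_le_rpow (sub_nonneg.2 hs'.2) ?_ hα.le
          linarith [hmesh i hi, hs'.1]
      _ = c := by rw [← Real.rpow_mul hc0.le, one_div_mul_cancel hα.ne', Real.rpow_one]
  rw [riemannSum, htel, ← Finset.sum_sub_distrib]
  calc _ ≤ ∑ i ∈ Finset.range n, M * c * L * (u (i + 1) - u i) := norm_sum_le_of_le _ hterm
    _ = M * c * L * t := by rw [← Finset.mul_sum, hu.sum_sub, sub_zero]
    _ ≤ M * c * L * T := by gcongr; exact ht.2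
    _ = (M * L * T) * c := by ring
    _ < (M * L * T + 1) * c := by gcongr; linarith
    _ = ε := by rw [hc]; field_simp

theorem exists_partition_mesh_lt {a b δ : ℝ} (hab : a ≤ b) (hδ : 0 < δ) :
    ∃ n u, IsPartition a b n u ∧ ∀ i < n, u (i + 1) - u i < δ := by
  rcases hab.eq_or_lt with rfl | hab
  · exact ⟨0, fun _ => a, ⟨rfl, rfl, by simp⟩, by simp⟩
  · obtain ⟨n, hn⟩ := exists_nat_gt ((b - a) / δ)
    have hba : 0 < b - a := sub_pos.2 hab
    have hn0 : (0 : ℝ) < n := lt_trans (by positivity) hn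
    have hstep : ∀ i : ℕ, a + (i + 1 : ℕ) * ((b - a) / n) - (a + i * ((b - a) / n)) =
        (b - a) / n := fun i => by push_cast; ring
    refine ⟨n, fun i => a + i * ((b - a) / n), ⟨by simp, by field_simp; ring, fun i _ => ?_⟩,
      fun i _ => ?_⟩
    · have := hstep i
      have : 0 < (b - a) / n := by positivity
      linarith
    · rw [hstep, div_lt_iff₀ hn0]
      rwa [div_lt_iff₀ hδ, mul_comm] at hn

theorem HasYoungIntegral.unique {f : ℝ → E} {g : ℝ → ℝ} {a b : ℝ} {x y : E} (hab : a ≤ b)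
    (hx : HasYoungIntegral f g a b x) (hy : HasYoungIntegral f g a b y) : x = y := by
  refine eq_of_forall_dist_le fun ε hε => ?_
  obtain ⟨δ, hδ, h⟩ := hx (ε / 2) (half_pos hε)
  obtain ⟨δ', hδ', h'⟩ := hy (ε / 2) (half_pos hε)
  obtain ⟨n, u, hu, hm⟩ := exists_partition_mesh_lt hab (lt_min hδ hδ')
  have h1 := h n u hu fun i hi => (hm i hi).trans_le (min_le_left _ _)
  have h2 := h' n u hu fun i hi => (hm i hi).trans_le (min_le_right _ _)
  rw [← dist_eq_norm] at h1 h2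
  linarith [dist_triangle_left x y (riemannSum f g n u)]

end Young

/-! ### The set-valued integral and the Hausdorff estimate. -/

section SetValued

variable {E : Type*} [NormedAddCommGroup E] [InnerProductSpace ℝ E]
  {α p T : ℝ} {g : ℝ → ℝ} {F F₁ F₂ : ℝ → ConvexBody E}

theorem IsHolder.abs_sub_le_rpow (hα : 0 < α) (hg : IsHolder α T g) {s t : ℝ} (hs : 0 ≤ s)
    (hst : s ≤ t) (ht : t ≤ T) : |g t - g s| ≤ holderConst α T g * T ^ α := by
  refine (hg.abs_sub_le hs hst ht).trans ?_
  refine mul_le_mul_of_nonneg_left ?_ (holderConst_nonneg α T g)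
  exact Real.rpow_le_rpow (sub_nonneg.2 hst) (by linarith) hα.le

theorem norm_youngValue_sub_le (hT : 0 < T) (hα : 0 < α) (hg : IsHolder α T g) (a : E)
    {φ ψ : ℝ → E} {w : ℝ → ℝ}
    (hφ : ∀ s ∈ Icc 0 T, ∀ t ∈ Icc 0 T, IntervalIntegrable φ volume s t)
    (hψ : ∀ s ∈ Icc 0 T, ∀ t ∈ Icc 0 T, IntervalIntegrable ψ volume s t)
    (hw : IntervalIntegrable w volume 0 T)
    (h : ∀ᵐ s ∂volume.restrict (Icc 0 T), ‖φ s - ψ s‖ ≤ w s) {t : ℝ} (ht : t ∈ Icc 0 T) :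
    ‖youngValue g a φ t - youngValue g a ψ t‖ ≤
      holderConst α T g * T ^ α * ∫ s in (0 : ℝ)..T, w s := by
  have h0 : (0 : ℝ) ∈ Icc 0 T := ⟨le_rfl, hT.le⟩
  have hgc := hg.continuousOn hα
  have hM : 0 ≤ holderConst α T g * T ^ α :=
    mul_nonneg (holderConst_nonneg α T g) (Real.rpow_nonneg hT.le α)
  have hsub : uIcc 0 t ⊆ uIcc 0 T := by
    rw [uIcc_of_le ht.1, uIcc_of_le hT.le]
    exact Icc_subset_Icc_right ht.2
  rw [youngValue, youngValue, add_sub_add_left_eq_sub, ← intervalIntegral.integral_sub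
    (intervalIntegrable_sub_smul hgc hφ (g t) h0 ht)
    (intervalIntegrable_sub_smul hgc hψ (g t) h0 ht), ← intervalIntegral.integral_const_mul]
  rw [ae_restrict_iff' measurableSet_Icc] at h
  calc _ ≤ ∫ s in (0 : ℝ)..t, holderConst α T g * T ^ α * w s := by
        refine intervalIntegral.norm_integral_le_of_norm_le ht.1 ?_
          ((hw.mono_set hsub).const_mul _)
        filter_upwards [h] with s hs hst
        rw [← smul_sub, norm_smul, Real.norm_eq_abs]
        exact mul_le_mul (hg.abs_sub_le_rpow hα hst.1.le hst.2 ht.2)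
          (hs ⟨hst.1.le, hst.2.trans ht.2⟩) (norm_nonneg _) hM
    _ ≤ ∫ s in (0 : ℝ)..T, holderConst α T g * T ^ α * w s := by
        refine intervalIntegral.integral_mono_interval le_rfl ht.1 ht.2 ?_ (hw.const_mul _)
        rw [EventuallyLE, ae_restrict_iff' measurableSet_Ioc]
        filter_upwards [h] with s hs hsT
        exact mul_nonneg hM ((norm_nonneg _).trans (hs (Ioc_subset_Icc_self hsT)))

variable [ProperSpace E]

theorem IS.hasYoungIntegral (hT : 0 < T) (hα : 0 < α) (hg : IsHolder α T g) (hp : 1 < p)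
    (hB : BddAbove (derivNorms T F)) {f : ℝ → E} (hf : f ∈ IS p T F) {t : ℝ}
    (ht : t ∈ Icc 0 T) : HasYoungIntegral f g 0 t (youngValue g (f 0) (deriv f) t) := by
  obtain ⟨hbv, -, hLp, hd⟩ := hf
  have hb := ae_norm_le_of_ae_mem hB (hd.mono fun t h => h.2)
  exact hasYoungIntegral_youngValue hT hα hg hLp.1 hb (sSup_derivNorms_nonneg T F)
    (fun x hx => hbv.eq_add_integral_deriv hp hT hLp.1 (hd.mono fun t h => h.1) hb hx) ht

theorem nonempty_IS (hT : 0 < T) (hp : 1 < p) (hF : HukuharaDifferentiable T F)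
    (hB : BddAbove (derivNorms T F)) : (IS p T F).Nonempty := by
  obtain ⟨a, ha⟩ := (F 0).nonempty
  -- The element of least norm in `D_H F s` serves as a measurable selection.
  have hm : AEStronglyMeasurable (fun s => proj (hukuharaDeriv T F s) 0)
      (volume.restrict (Icc 0 T)) :=
    continuous_proj.comp_aestronglyMeasurable
      (hF.aestronglyMeasurable_hukuharaDeriv.prodMk aestronglyMeasurable_const)
  exact ⟨_, add_integral_mem_IS hT hp hF hB ha hm
    (Eventually.of_forall fun s => proj_mem _ _)⟩

theorem setYoungIntegral_nonempty (hT : 0 < T) (hα : 0 < α) (hg : IsHolder α T g) (hp : 1 < p)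
    (hF : HukuharaDifferentiable T F) (hB : BddAbove (derivNorms T F)) {t : ℝ}
    (ht : t ∈ Icc 0 T) : (setYoungIntegral p T F g t).Nonempty := by
  obtain ⟨f, hf⟩ := nonempty_IS hT hp hF hB
  exact ⟨_, subset_closure ⟨f, hf, IS.hasYoungIntegral hT hα hg hp hB hf ht⟩⟩

theorem isCompact_setYoungIntegral (hT : 0 < T) (hα : 0 < α) (hg : IsHolder α T g) (hp : 1 < p)
    (hB : BddAbove (derivNorms T F)) {t : ℝ} (ht : t ∈ Icc 0 T) :
    IsCompact (setYoungIntegral p T F g t) := by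
  refine Bornology.IsBounded.isCompact_closure ?_
  refine isBounded_iff_forall_norm_le.2 ⟨holderConst α T g * T ^ α * setNorm (F 0) +
    holderConst α T g * T ^ α * sSup (derivNorms T F) * |t - 0|, ?_⟩
  rintro x ⟨f, hf, hx⟩
  rw [hx.unique ht.1 (IS.hasYoungIntegral hT hα hg hp hB hf ht)]
  have h0 : (0 : ℝ) ∈ Icc 0 T := ⟨le_rfl, hT.le⟩
  have hM : 0 ≤ holderConst α T g * T ^ α :=
    mul_nonneg (holderConst_nonneg α T g) (Real.rpow_nonneg hT.le α)
  obtain ⟨-, hsel, -, hd⟩ := hf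
  have hb := ae_norm_le_of_ae_mem hB (hd.mono fun t h => h.2)
  refine (norm_add_le _ _).trans (add_le_add ?_ ?_)
  · rw [norm_smul, Real.norm_eq_abs]
    exact mul_le_mul (hg.abs_sub_le_rpow hα le_rfl ht.1 ht.2) (norm_le_setNorm (hsel 0 h0))
      (norm_nonneg _) hM
  · refine intervalIntegral.norm_integral_le_of_norm_le_const_ae ?_
    rw [ae_restrict_iff' measurableSet_Icc] at hb
    filter_upwards [hb] with s hs hst
    rw [uIoc_of_le ht.1] at hst
    rw [norm_smul, Real.norm_eq_abs]
    exact mul_le_mul (hg.abs_sub_le_rpow hα hst.1.le hst.2 ht.2)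
      (hs ⟨hst.1.le, hst.2.trans ht.2⟩) (norm_nonneg _) hM

theorem intervalIntegrable_dist_hukuharaDeriv (hT : 0 < T) (hF₁ : HukuharaDifferentiable T F₁)
    (hF₂ : HukuharaDifferentiable T F₂) (hB₁ : BddAbove (derivNorms T F₁))
    (hB₂ : BddAbove (derivNorms T F₂)) :
    IntervalIntegrable (fun s => dist (hukuharaDeriv T F₁ s) (hukuharaDeriv T F₂ s))
      volume 0 T := by
  refine intervalIntegrable_of_norm_le (T := T)
    (L := sSup (derivNorms T F₁) + sSup (derivNorms T F₂))
    (hF₁.aestronglyMeasurable_hukuharaDeriv.dist hF₂.aestronglyMeasurable_hukuharaDeriv) ?_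
    ⟨le_rfl, hT.le⟩ ⟨hT.le, le_rfl⟩
  filter_upwards [ae_restrict_mem measurableSet_Icc] with s hs
  rw [Real.norm_eq_abs, abs_of_nonneg dist_nonneg]
  exact (dist_triangle_right _ _ 0).trans
    (add_le_add (setNorm_hukuharaDeriv_le hB₁ hs) (setNorm_hukuharaDeriv_le hB₂ hs))

/-- A selection of `F₁` is followed by the selection of `F₂` with the same initial value whose
derivative is the metric projection onto the Hukuhara derivative of `F₂`. -/
theorem exists_hasYoungIntegral_dist_le (hT : 0 < T) (hα : 0 < α) (hg : IsHolder α T g)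
    (hp : 1 < p) (hF₁ : HukuharaDifferentiable T F₁) (hF₂ : HukuharaDifferentiable T F₂)
    (hB₁ : BddAbove (derivNorms T F₁)) (hB₂ : BddAbove (derivNorms T F₂)) (h0 : F₁ 0 = F₂ 0)
    {t : ℝ} (ht : t ∈ Icc 0 T) {f : ℝ → E} (hf : f ∈ IS p T F₁) {x : E}
    (hx : HasYoungIntegral f g 0 t x) :
    ∃ y, (∃ f' ∈ IS p T F₂, HasYoungIntegral f' g 0 t y) ∧
      dist x y ≤ holderConst α T g * T ^ α *
        ∫ s in (0 : ℝ)..T, dist (hukuharaDeriv T F₁ s) (hukuharaDeriv T F₂ s) := by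
  rw [hx.unique ht.1 (IS.hasYoungIntegral hT hα hg hp hB₁ hf ht)]
  obtain ⟨-, hsel, hLp, hd⟩ := hf
  set φ : ℝ → E := fun s => proj (hukuharaDeriv T F₂ s) (deriv f s)
  have hm : AEStronglyMeasurable φ (volume.restrict (Icc 0 T)) :=
    continuous_proj.comp_aestronglyMeasurable
      (hF₂.aestronglyMeasurable_hukuharaDeriv.prodMk hLp.1)
  have hmem : ∀ᵐ s ∂volume.restrict (Icc 0 T), φ s ∈ hukuharaDeriv T F₂ s :=
    Eventually.of_forall fun s => proj_mem _ _
  have hb₁ := ae_norm_le_of_ae_mem hB₁ (hd.mono fun t h => h.2)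
  have hb₂ := ae_norm_le_of_ae_mem hB₂ hmem
  have ha : f 0 ∈ F₂ 0 := h0 ▸ hsel 0 ⟨le_rfl, hT.le⟩
  refine ⟨youngValue g (f 0) φ t, ⟨_, add_integral_mem_IS hT hp hF₂ hB₂ ha hm hmem,
    hasYoungIntegral_youngValue hT hα hg hm hb₂ (sSup_derivNorms_nonneg T F₂)
      (fun _ _ => rfl) ht⟩, ?_⟩
  rw [dist_eq_norm]
  refine norm_youngValue_sub_le hT hα hg (f 0)
    (fun s hs t ht => intervalIntegrable_of_norm_le hLp.1 hb₁ hs ht)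
    (fun s hs t ht => intervalIntegrable_of_norm_le hm hb₂ hs ht)
    (intervalIntegrable_dist_hukuharaDeriv hT hF₁ hF₂ hB₁ hB₂) ?_ ht
  filter_upwards [hd] with s hs
  rw [← dist_eq_norm]
  exact dist_proj_le_dist _ hs.2

/-- Integration by parts bounds the Hausdorff distance by the last term of the estimate of `theorem6`
alone, for every admissible `p` and with no condition linking `p` and `α`. -/
theorem hausdorffDist_setYoungIntegral_le (hT : 0 < T) (hα : 0 < α) (hg : IsHolder α T g)
    (hp : 1 < p) (hF₁ : HukuharaDifferentiable T F₁) (hF₂ : HukuharaDifferentiable T F₂)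
    (hB₁ : BddAbove (derivNorms T F₁)) (hB₂ : BddAbove (derivNorms T F₂)) (h0 : F₁ 0 = F₂ 0)
    {t : ℝ} (ht : t ∈ Icc 0 T) :
    Metric.hausdorffDist (setYoungIntegral p T F₁ g t) (setYoungIntegral p T F₂ g t) ≤
      holderConst α T g * T ^ α *
        ∫ s in (0 : ℝ)..T, dist (hukuharaDeriv T F₁ s) (hukuharaDeriv T F₂ s) := by
  -- Closures do not affect the Hausdorff distance, so only genuine Young integrals need to be
  -- matched.
  rw [setYoungIntegral, setYoungIntegral, Metric.hausdorffDist_closure]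
  refine Metric.hausdorffDist_le_of_mem_dist ?_ ?_ ?_
  · exact mul_nonneg (mul_nonneg (holderConst_nonneg α T g) (Real.rpow_nonneg hT.le α))
      (intervalIntegral.integral_nonneg hT.le fun _ _ => dist_nonneg)
  · rintro x ⟨f, hf, hx⟩
    exact exists_hasYoungIntegral_dist_le hT hα hg hp hF₁ hF₂ hB₁ hB₂ h0 ht hf hx
  · rintro x ⟨f, hf, hx⟩
    simp_rw [dist_comm (hukuharaDeriv T F₁ _)]
    exact exists_hasYoungIntegral_dist_le hT hα hg hp hF₂ hF₁ hB₂ hB₁ h0.symm ht hf hx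

end SetValued

end

end SetYoung

theorem theorem6 (d : ℕ) (T : ℝ) (hT : 0 < T) (α β : ℝ) (hα : 0 < α) (hα1 : α ≤ 1)
    (hβ : 0 < β) (hβ1 : β ≤ 1) (g : ℝ → ℝ) (hg : IsHolder α T g)
    (ρ : ℝ) (hρα : 1 - α < ρ) (hρβ : ρ < β) :
    ∃ C : ℝ, 0 < C ∧
      ∀ p : ℝ, 1 < p → 1 < 1 / p + α →
      ∀ F₁ F₂ : ℝ → ConvexBody (EuclideanSpace ℝ (Fin d)),
        HukuharaDifferentiable T F₁ → HukuharaDifferentiable T F₂ →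
        BddAbove (derivNorms T F₁) → BddAbove (derivNorms T F₂) →
        F₁ 0 = F₂ 0 →
        -- the objects in the inequality are well defined
        IntervalIntegrable (fun s => dist (hukuharaDeriv T F₁ s) (hukuharaDeriv T F₂ s))
          MeasureTheory.volume 0 T ∧
        ∀ t ∈ Set.Icc 0 T,
          (∀ f ∈ IS p T F₁ ∪ IS p T F₂, ∃ x, HasYoungIntegral f g 0 t x) ∧
          (setYoungIntegral p T F₁ g t).Nonempty ∧ IsCompact (setYoungIntegral p T F₁ g t) ∧
          (setYoungIntegral p T F₂ g t).Nonempty ∧ IsCompact (setYoungIntegral p T F₂ g t) ∧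
          -- the inequality
          ∀ θ ∈ Set.Ioc (0 : ℝ) 1,
            Metric.hausdorffDist (setYoungIntegral p T F₁ g t) (setYoungIntegral p T F₂ g t) ≤
              C * ((∫ s in (0 : ℝ)..T, dist (hukuharaDeriv T F₁ s) (hukuharaDeriv T F₂ s)) +
                  (T + T ^ (1 - β)) * (sSup (derivNorms T F₁) + sSup (derivNorms T F₂)) * θ ^ β) *
                θ ^ (-ρ) +
              holderConst α T g * T ^ α *
                ∫ s in (0 : ℝ)..T, dist (hukuharaDeriv T F₁ s) (hukuharaDeriv T F₂ s) := by
  -- Any positive constant works, since it multiplies a nonnegative quantity.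
  refine ⟨1, one_pos, fun p hp _ F₁ F₂ hF₁ hF₂ hB₁ hB₂ h0 =>
    ⟨intervalIntegrable_dist_hukuharaDeriv hT hF₁ hF₂ hB₁ hB₂,
      fun t ht => ⟨?_, ?_, ?_, ?_, ?_, ?_⟩⟩⟩
  · rintro f (hf | hf)
    · exact ⟨_, IS.hasYoungIntegral hT hα hg hp hB₁ hf ht⟩
    · exact ⟨_, IS.hasYoungIntegral hT hα hg hp hB₂ hf ht⟩
  · exact setYoungIntegral_nonempty hT hα hg hp hF₁ hB₁ ht
  · exact isCompact_setYoungIntegral hT hα hg hp hB₁ ht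
  · exact setYoungIntegral_nonempty hT hα hg hp hF₂ hB₂ ht
  · exact isCompact_setYoungIntegral hT hα hg hp hB₂ ht
  · intro θ hθ
    refine (hausdorffDist_setYoungIntegral_le hT hα hg hp hF₁ hF₂ hB₁ hB₂ h0 ht).trans
      (le_add_of_nonneg_left ?_)
    have h1 : 0 ≤ ∫ s in (0 : ℝ)..T, dist (hukuharaDeriv T F₁ s) (hukuharaDeriv T F₂ s) :=
      intervalIntegral.integral_nonneg hT.le fun _ _ => dist_nonneg
    have h2 := sSup_derivNorms_nonneg T F₁
    have h3 := sSup_derivNorms_nonneg T F₂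
    have h4 := hθ.1
    positivity
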